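/- Let $d\ge 1$ be an integer and let $p,q$ be real numbers with $0<p<q$ and $d>\frac{qp}{q-p}$. Let $\mu$ be a Borel probability measure on $\mathbb{R}^d$ (with Euclidean norm $\|\cdot\|$), let $g:\mathbb{R}^d\to\mathbb{R}^d$ be Borel measurable, and let $g_{\max}\in\mathbb{R}$ be such that $\|g(x)\|\le g_{\max}$ for $\mu$-almost every $x$. For $\theta\in\mathbb{R}^d$ put $$M(\theta)=\int e^{\theta^T g(x)}\,\mu(dx),\qquad \mu_\theta(A)=\frac{1}{M(\theta)}\int_A e^{\theta^T g(x)}\,\mu(dx),\qquad V(\theta)=\frac{e^{\|\theta\|g_{\max}}M(2\theta)}{M(\theta)},$$ and for a probability measure $\nu$ on $\mathbb{R}^d$ put $M_q(\nu)=\int\|x\|^q\,\nu(dx)\in[0,\infty]$. Let $x_1,x_2,\dots$ be i.i.d. random vectors with law $\mu$, and for $N\ge 1$ let $$\mu_{N,\theta}=\frac1N\sum_{i=1}^N\frac{w_i}{w_N^*}\,\delta_{x_i},\qquad w_i=e^{\theta^T g(x_i)},\qquad w_N^*=\frac1N\sum_{j=1}^N w_j .$$ For probability measures $\nu_1,\nu_2$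 on $\mathbb{R}^d$ let $\mathcal T_p(\nu_1,\nu_2)=\inf_\pi\int\|x-y\|^p\,\pi(dx,dy)\in[0,\infty]$, the infimum being over all couplings $\pi$ of $\nu_1$ and $\nu_2$. If $(\theta_N)_{N\ge 1}$ is a sequence in $\mathbb{R}^d$ such that, as $N\to\infty$, $$M_q(\mu_{\theta_N})^{p/q}\left(V(\theta_N)\,N^{-p/d}+N^{-1/2}\right)\to 0,$$ then $$\mathbb{E}\,\mathcal T_p(\mu_{N,\theta_N},\mu_{\theta_N})\to 0\qquad(N\to\infty).$$ -/

import Mathlib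

open MeasureTheory ProbabilityTheory Filter Topology
open scoped ENNReal

namespace Reweighting

/-- The data space `ℝ^d` with its Euclidean norm and inner product. -/
abbrev Space (d : ℕ) := EuclideanSpace ℝ (Fin d)

/-- The weight `exp (θᵀ g(x))`. -/
noncomputable def weight {d : ℕ} (g : Space d → Space d) (θ x : Space d) : ℝ :=
  Real.exp (inner ℝ θ (g x))

/-- `M(θ) = E_{x ∼ μ} [exp (θᵀ g(x))]`. -/
noncomputable def tiltMass {d : ℕ} (μ : Measure (Space d)) (g : Space d → Space d)
    (θ : Space d) : ℝ :=
  ∫ x, weight g θ x ∂μ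

/-- The exponential tilt `μ_θ`, i.e. the measure with density `exp (θᵀ g(x)) / M(θ)` with
respect to `μ`. -/
noncomputable def tiltedLaw {d : ℕ} (μ : Measure (Space d)) (g : Space d → Space d)
    (θ : Space d) : Measure (Space d) :=
  μ.tilted (fun x => inner ℝ θ (g x))

/-- The average weight `w*_n = (1/n) ∑_j w_j` of the samples `x 0, …, x (n - 1)`. -/
noncomputable def averageWeight {d : ℕ} (g : Space d → Space d) (θ : Space d) (n : ℕ)
    (x : ℕ → Space d) : ℝ :=
  (1 / (n : ℝ)) * ∑ j ∈ Finset.range n, weight g θ (x j)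

/-- The plug-in estimator `μ_{n,θ} = (1/n) ∑_i (w_i / w*_n) δ_{x_i}` built from the samples
`x 0, …, x (n - 1)`. -/
noncomputable def plugIn {d : ℕ} (g : Space d → Space d) (θ : Space d) (n : ℕ)
    (x : ℕ → Space d) : Measure (Space d) :=
  ∑ i ∈ Finset.range n,
    ENNReal.ofReal ((1 / (n : ℝ)) * (weight g θ (x i) / averageWeight g θ n x)) •
      Measure.dirac (x i)

/-- The absolute moment `M_q(ν) = E_{x ∼ ν} ‖x‖^q`, with value `∞` when the moment is infinite. -/
noncomputable def absMoment {d : ℕ} (q : ℝ) (ν : Measure (Space d)) : ℝ≥0∞ :=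
  ∫⁻ x, ‖x‖ₑ ^ q ∂ν

/-- The couplings of two measures: probability measures on the product with the given marginals. -/
def couplings {d : ℕ} (ν₁ ν₂ : Measure (Space d)) : Set (Measure (Space d × Space d)) :=
  {π | IsProbabilityMeasure π ∧ π.fst = ν₁ ∧ π.snd = ν₂}

/-- The transport cost `T_p(ν₁, ν₂) = inf_π E_{(x,y) ∼ π} ‖x - y‖^p` over all couplings. -/
noncomputable def transportCost {d : ℕ} (p : ℝ) (ν₁ ν₂ : Measure (Space d)) : ℝ≥0∞ :=
  ⨅ π ∈ couplings ν₁ ν₂, ∫⁻ z, ‖z.1 - z.2‖ₑ ^ p ∂π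

/-- `V = exp (‖θ‖ g_max) M(2θ) / M(θ)`. -/
noncomputable def growthFactor {d : ℕ} (μ : Measure (Space d)) (g : Space d → Space d)
    (gmax : ℝ) (θ : Space d) : ℝ :=
  Real.exp (‖θ‖ * gmax) * tiltMass μ g ((2 : ℝ) • θ) / tiltMass μ g θ

end Reweighting

namespace Reweighting

/-! The growth condition forces the densities `dμ_θ/dμ` along the sequence to be at most `C N^ε` for
every `ε > 0`; a crude discretisation bound then suffices.

Put `A = e^{‖θ‖ gmax} M(θ)`. Then `A⁻¹` times the `q`-moment of `μ` is at most that of `μ_θ`, and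
Jensen gives `A ≤ V(θ)`. So the hypothesis makes `A^{1-p/q} N^{-p/d}` bounded. Unless `g` is a.e.
constant (then the density is 1), `c₀ = gmax - ‖∫ g dμ‖ > 0` and, by Jensen again, `A ≥ e^{c₀‖θ‖}`;
hence `‖θ_N‖ = O(log N)` (`eventually_norm_le_log`). Covering the ball of radius `gmax` by small
balls bounds the density by `C e^{δ‖θ‖}` for any `δ > 0` (`exists_tiltDensity_le`). Together these
yield `eventually_tiltDensity_le`.

For a density bounded by `L`, `lintegral_transportCost_le` splits the cost over finitely many cells:
the mesh, the fluctuations of the cell masses (order `L/√N` each), and the tail outside the cells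
(order `L²` times the tail of `μ`). A grid of mesh `N^{-η}` reaching radius `N^η`, with `η` and then
`ε` small, sends every term to zero. -/

/-! ### Transport cost bounds from partial couplings and cells. -/

lemma enorm_sub_rpow_le {E : Type*} [NormedAddCommGroup E] {p : ℝ} (hp : 0 ≤ p) (x y : E) :
    ‖x - y‖ₑ ^ p ≤ 2 ^ p * (‖x‖ₑ ^ p + ‖y‖ₑ ^ p) := by
  have h1 : ‖x - y‖ₑ ≤ 2 * max ‖x‖ₑ ‖y‖ₑ := by
    refine enorm_sub_le.trans ?_
    rw [two_mul]
    exact add_le_add (le_max_left _ _) (le_max_right _ _)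
  calc ‖x - y‖ₑ ^ p ≤ (2 * max ‖x‖ₑ ‖y‖ₑ) ^ p := ENNReal.rpow_le_rpow h1 hp
    _ = 2 ^ p * max (‖x‖ₑ ^ p) (‖y‖ₑ ^ p) := by
      rw [ENNReal.mul_rpow_of_nonneg _ _ hp, (ENNReal.monotone_rpow_of_nonneg hp).map_max]
    _ ≤ _ := by
      gcongr
      exact max_le le_self_add le_add_self

lemma fst_finsetSum {α β ι : Type*} [MeasurableSpace α] [MeasurableSpace β]
    (s : Finset ι) (π : ι → Measure (α × β)) :
    (∑ k ∈ s, π k).fst = ∑ k ∈ s, (π k).fst := by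
  ext t ht
  simp [Measure.fst_apply ht, Measure.finsetSum_apply]

lemma snd_finsetSum {α β ι : Type*} [MeasurableSpace α] [MeasurableSpace β]
    (s : Finset ι) (π : ι → Measure (α × β)) :
    (∑ k ∈ s, π k).snd = ∑ k ∈ s, (π k).snd := by
  ext t ht
  simp [Measure.snd_apply ht, Measure.finsetSum_apply]

lemma fst_smul_prod {α β : Type*} [MeasurableSpace α] [MeasurableSpace β]
    (c : ℝ≥0∞) (ρ : Measure α) (τ : Measure β) [SFinite τ] :
    (c • ρ.prod τ).fst = (c * τ Set.univ) • ρ := by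
  ext t ht
  rw [Measure.fst_apply ht, ← Set.prod_univ]
  simp [mul_comm, mul_left_comm]

lemma snd_smul_prod {α β : Type*} [MeasurableSpace α] [MeasurableSpace β]
    (c : ℝ≥0∞) (ρ : Measure α) (τ : Measure β) [SFinite τ] :
    (c • ρ.prod τ).snd = (c * ρ Set.univ) • τ := by
  ext t ht
  rw [Measure.snd_apply ht, ← Set.univ_prod]
  simp [mul_assoc]

/-- The case `m = 0`, where `m⁻¹ = ∞`, is included because then `ρ = 0`; it lets the completed
coupling below be written without a case split. -/
lemma inv_mass_smul_self {α : Type*} [MeasurableSpace α] (ρ : Measure α) {m : ℝ≥0∞}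
    (hm : ρ Set.univ = m) (h : m ≠ ∞) : (m⁻¹ * m) • ρ = ρ := by
  by_cases h0 : m = 0
  · have : ρ = 0 := by rw [← Measure.measure_univ_eq_zero, hm, h0]
    simp [this]
  · rw [ENNReal.inv_mul_cancel h0 h, one_smul]

/-- A partial coupling of `ν₁` and `ν₂` is completed by the product of the uncoupled parts. -/
lemma transportCost_le_of_partial {d : ℕ} {p : ℝ} (hp : 0 ≤ p) {ν₁ ν₂ : Measure (Space d)}
    [IsProbabilityMeasure ν₁] [IsProbabilityMeasure ν₂] (κ : Measure (Space d × Space d))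
    {ρ₁ ρ₂ : Measure (Space d)} (h₁ : κ.fst + ρ₁ = ν₁) (h₂ : κ.snd + ρ₂ = ν₂) :
    transportCost p ν₁ ν₂ ≤ ∫⁻ z, ‖z.1 - z.2‖ₑ ^ p ∂κ +
      2 ^ p * (∫⁻ x, ‖x‖ₑ ^ p ∂ρ₁ + ∫⁻ x, ‖x‖ₑ ^ p ∂ρ₂) := by
  have hκ₁ : κ.fst Set.univ + ρ₁ Set.univ = 1 := by
    rw [← Measure.add_apply, h₁, measure_univ]
  have hκ₂ : κ.snd Set.univ + ρ₂ Set.univ = 1 := by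
    rw [← Measure.add_apply, h₂, measure_univ]
  rw [Measure.fst_univ] at hκ₁
  rw [Measure.snd_univ] at hκ₂
  have hκtop : κ Set.univ ≠ ∞ := ne_top_of_le_ne_top ENNReal.one_ne_top (hκ₁ ▸ le_self_add)
  obtain ⟨m, hm⟩ : ∃ m, ρ₁ Set.univ = m := ⟨_, rfl⟩
  have hm₂ : ρ₂ Set.univ = m := by
    rw [← hm]
    exact (ENNReal.add_right_inj hκtop).1 (hκ₂.trans hκ₁.symm)
  have hmtop : m ≠ ∞ := by
    rw [← hm]
    exact ne_top_of_le_ne_top ENNReal.one_ne_top (hκ₁ ▸ le_add_self)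
  have : IsFiniteMeasure ρ₁ := ⟨by rw [hm]; exact hmtop.lt_top⟩
  have : IsFiniteMeasure ρ₂ := ⟨by rw [hm₂]; exact hmtop.lt_top⟩
  -- Both leftovers have the same mass `m`, so dividing their product by `m` gives it marginals `ρ₁`
  -- and `ρ₂`.
  set π := κ + m⁻¹ • ρ₁.prod ρ₂ with hπ
  have hfst : π.fst = ν₁ := by
    rw [hπ, Measure.fst_add, fst_smul_prod, hm₂, inv_mass_smul_self ρ₁ hm hmtop, h₁]
  have hsnd : π.snd = ν₂ := by
    rw [hπ, Measure.snd_add, snd_smul_prod, hm, inv_mass_smul_self ρ₂ hm₂ hmtop, h₂]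
  have hprob : IsProbabilityMeasure π := ⟨by rw [← Measure.fst_univ, hfst, measure_univ]⟩
  refine (iInf₂_le π ⟨hprob, hfst, hsnd⟩).trans ?_
  rw [hπ, lintegral_add_measure]
  gcongr
  have hmeas : Measurable fun x : Space d => ‖x‖ₑ ^ p := by fun_prop
  have hf₁ : (m⁻¹ • ρ₁.prod ρ₂).fst = ρ₁ := by
    rw [fst_smul_prod, hm₂, inv_mass_smul_self ρ₁ hm hmtop]
  have hf₂ : (m⁻¹ • ρ₁.prod ρ₂).snd = ρ₂ := by
    rw [snd_smul_prod, hm, inv_mass_smul_self ρ₂ hm₂ hmtop]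
  calc ∫⁻ z, ‖z.1 - z.2‖ₑ ^ p ∂(m⁻¹ • ρ₁.prod ρ₂)
      ≤ ∫⁻ z, 2 ^ p * (‖z.1‖ₑ ^ p + ‖z.2‖ₑ ^ p) ∂(m⁻¹ • ρ₁.prod ρ₂) :=
        lintegral_mono fun z => enorm_sub_rpow_le hp _ _
    _ = 2 ^ p * (∫⁻ x, ‖x‖ₑ ^ p ∂(m⁻¹ • ρ₁.prod ρ₂).fst
          + ∫⁻ x, ‖x‖ₑ ^ p ∂(m⁻¹ • ρ₁.prod ρ₂).snd) := by
        rw [lintegral_const_mul _ (by fun_prop), lintegral_add_left (by fun_prop),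
          Measure.fst, Measure.snd, lintegral_map hmeas measurable_fst,
          lintegral_map hmeas measurable_snd]
    _ = _ := by rw [hf₁, hf₂]

lemma sum_restrict_add_compl {α ι : Type*} [MeasurableSpace α] (ν : Measure α) (s : Finset ι)
    {A : ι → Set α} (hA : ∀ k, MeasurableSet (A k)) (hd : (s : Set ι).PairwiseDisjoint A) :
    ∑ k ∈ s, ν.restrict (A k) + ν.restrict (⋃ k ∈ s, A k)ᶜ = ν := by
  have : ν.restrict (⋃ k ∈ s, A k) = ∑ k ∈ s, ν.restrict (A k) := by
    rw [Measure.restrict_biUnion_finset hd hA, Measure.sum_fintype,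
      Finset.sum_coe_sort s fun k => ν.restrict (A k)]
  rw [← this]
  exact Measure.restrict_add_restrict_compl (s.measurableSet_biUnion fun k _ => hA k)

/-- The mass left over on the cells after removing the common part. -/
lemma lintegral_residual_le {d : ℕ} {p : ℝ} (hp : 0 ≤ p) {ι : Type*} (s : Finset ι)
    {A : ι → Set (Space d)} (hA : ∀ k, MeasurableSet (A k)) {B : ℝ≥0∞}
    (hB : ∀ k ∈ s, ∀ x ∈ A k, ‖x‖ₑ ≤ B) (ν ν' : Measure (Space d)) [IsProbabilityMeasure ν]
    [IsProbabilityMeasure ν'] :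
    ∫⁻ x, ‖x‖ₑ ^ p ∂(∑ k ∈ s, (1 - min (ν (A k)) (ν' (A k)) / ν (A k)) • ν.restrict (A k)
        + ν.restrict (⋃ k ∈ s, A k)ᶜ)
      ≤ B ^ p * ∑ k ∈ s, ENNReal.ofReal |ν.real (A k) - ν'.real (A k)|
        + ∫⁻ x in (⋃ k ∈ s, A k)ᶜ, ‖x‖ₑ ^ p ∂ν := by
  rw [lintegral_add_measure, lintegral_finsetSum_measure]
  gcongr
  rw [Finset.mul_sum]
  refine Finset.sum_le_sum fun k hk => ?_
  rw [lintegral_smul_measure, smul_eq_mul]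
  have h1 : ∫⁻ x in A k, ‖x‖ₑ ^ p ∂ν ≤ B ^ p * ν (A k) := by
    rw [← setLIntegral_const]
    exact setLIntegral_mono' (hA k) fun x hx => ENNReal.rpow_le_rpow (hB k hk x hx) hp
  -- For positive cell mass the left side is the positive part of `ν (A k) - ν' (A k)`.
  have h2 : (1 - min (ν (A k)) (ν' (A k)) / ν (A k)) * ν (A k)
      ≤ ENNReal.ofReal |ν.real (A k) - ν'.real (A k)| := by
    by_cases h0 : ν (A k) = 0
    · simp [h0]
    rw [ENNReal.sub_mul (fun _ _ => measure_ne_top _ _), one_mul,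
      ENNReal.div_mul_cancel h0 (measure_ne_top _ _), tsub_le_iff_left]
    rcases le_total (ν (A k)) (ν' (A k)) with h | h
    · rw [min_eq_left h]; exact le_self_add
    · rw [min_eq_right h, ← ofReal_measureReal (μ := ν) (s := A k),
        ← ofReal_measureReal (μ := ν') (s := A k), ← ENNReal.ofReal_add (by positivity) (abs_nonneg _)]
      apply ENNReal.ofReal_le_ofReal
      linarith [le_abs_self (ν.real (A k) - ν'.real (A k))]
  calc _ ≤ (1 - min (ν (A k)) (ν' (A k)) / ν (A k)) * (B ^ p * ν (A k)) := by gcongr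
    _ = B ^ p * ((1 - min (ν (A k)) (ν' (A k)) / ν (A k)) * ν (A k)) := by ring
    _ ≤ _ := by gcongr

lemma min_div_mul_mul_right_cancel {α : Type*} [MeasurableSpace α] (ν ν' : Measure α) [IsFiniteMeasure ν]
    [IsFiniteMeasure ν'] {A : Set α} :
    (min (ν A) (ν' A) / (ν A * ν' A) * ν' A) = min (ν A) (ν' A) / ν A := by
  by_cases h0 : ν A = 0
  · simp [h0]
  by_cases h1 : ν' A = 0
  · simp [h1]
  rw [div_eq_mul_inv, div_eq_mul_inv, ENNReal.mul_inv (by simp [h0]) (by simp [h1]), mul_assoc,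
    mul_assoc, ENNReal.inv_mul_cancel h1 (measure_ne_top _ _), mul_one]

/-- Transport bound through a finite family of disjoint cells of small diameter. -/
theorem transportCost_le_cells {d : ℕ} {p : ℝ} (hp : 0 ≤ p) {ι : Type*} (s : Finset ι)
    {A : ι → Set (Space d)} (hA : ∀ k, MeasurableSet (A k))
    (hd : (s : Set ι).PairwiseDisjoint A) {B r : ℝ≥0∞}
    (hB : ∀ k ∈ s, ∀ x ∈ A k, ‖x‖ₑ ≤ B) (hr : ∀ k ∈ s, ∀ x ∈ A k, ∀ y ∈ A k, ‖x - y‖ₑ ≤ r)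
    (ν₁ ν₂ : Measure (Space d)) [IsProbabilityMeasure ν₁] [IsProbabilityMeasure ν₂] :
    transportCost p ν₁ ν₂ ≤ r ^ p + 2 ^ p *
      (2 * B ^ p * ∑ k ∈ s, ENNReal.ofReal |ν₁.real (A k) - ν₂.real (A k)|
        + (∫⁻ x in (⋃ k ∈ s, A k)ᶜ, ‖x‖ₑ ^ p ∂ν₁ + ∫⁻ x in (⋃ k ∈ s, A k)ᶜ, ‖x‖ₑ ^ p ∂ν₂)) := by
  -- With this factor the product coupling on cell `k` has mass `min (ν₁ (A k)) (ν₂ (A k))`, the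
  -- most that can stay inside the cell. A cell null for either measure contributes nothing, since
  -- `0 / 0 = 0`.
  set c : ι → ℝ≥0∞ := fun k => min (ν₁ (A k)) (ν₂ (A k)) / (ν₁ (A k) * ν₂ (A k)) with hc
  set κ : Measure (Space d × Space d) :=
    ∑ k ∈ s, c k • (ν₁.restrict (A k)).prod (ν₂.restrict (A k)) with hκ
  have hdiv : ∀ (a b : ℝ≥0∞), min a b / a ≤ 1 := fun a b =>
    ENNReal.div_le_of_le_mul (by simp)
  have hfst : κ.fst = ∑ k ∈ s, (min (ν₁ (A k)) (ν₂ (A k)) / ν₁ (A k)) • ν₁.restrict (A k) := by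
    rw [hκ, fst_finsetSum]
    refine Finset.sum_congr rfl fun k _ => ?_
    rw [fst_smul_prod, Measure.restrict_apply_univ, hc, min_div_mul_mul_right_cancel]
  have hsnd : κ.snd = ∑ k ∈ s, (min (ν₂ (A k)) (ν₁ (A k)) / ν₂ (A k)) • ν₂.restrict (A k) := by
    rw [hκ, snd_finsetSum]
    refine Finset.sum_congr rfl fun k _ => ?_
    rw [snd_smul_prod, Measure.restrict_apply_univ, hc]
    simp only []
    rw [min_comm, mul_comm (ν₁ (A k)), min_div_mul_mul_right_cancel]
  have key : ∀ ν ν' : Measure (Space d),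
      ∑ k ∈ s, (min (ν (A k)) (ν' (A k)) / ν (A k)) • ν.restrict (A k) +
      (∑ k ∈ s, (1 - min (ν (A k)) (ν' (A k)) / ν (A k)) • ν.restrict (A k)
        + ν.restrict (⋃ k ∈ s, A k)ᶜ) = ν := by
    intro ν ν'
    rw [← add_assoc, ← Finset.sum_add_distrib]
    refine Eq.trans ?_ (sum_restrict_add_compl ν s hA hd)
    congr 1
    refine Finset.sum_congr rfl fun k _ => ?_
    rw [← add_smul, add_tsub_cancel_of_le (hdiv _ _), one_smul]
  refine (transportCost_le_of_partial hp κ (hfst ▸ key ν₁ ν₂) (hsnd ▸ key ν₂ ν₁)).trans ?_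
  have hκmass : κ Set.univ ≤ 1 := by
    have := congrArg (fun ν => ν Set.univ) (hfst ▸ key ν₁ ν₂ :
      κ.fst + _ = ν₁)
    simp only [Measure.add_apply _ _ Set.univ, Measure.fst_univ, measure_univ] at this
    exact this ▸ le_self_add
  refine add_le_add ?_ ?_
  · calc ∫⁻ z, ‖z.1 - z.2‖ₑ ^ p ∂κ ≤ ∫⁻ _, r ^ p ∂κ := by
          rw [hκ, lintegral_finsetSum_measure, lintegral_finsetSum_measure]
          refine Finset.sum_le_sum fun k hk => ?_
          rw [lintegral_smul_measure, lintegral_smul_measure, Measure.prod_restrict]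
          gcongr 1
          exact setLIntegral_mono' ((hA k).prod (hA k)) fun z hz =>
            ENNReal.rpow_le_rpow (hr k hk _ hz.1 _ hz.2) hp
      _ ≤ r ^ p := by
          rw [lintegral_const]
          exact mul_le_of_le_one_right' hκmass
  · gcongr 2 ^ p * ?_
    refine (add_le_add (lintegral_residual_le hp s hA hB ν₁ ν₂)
      (lintegral_residual_le hp s hA hB ν₂ ν₁)).trans (le_of_eq ?_)
    simp_rw [abs_sub_comm (ν₂.real _)]
    ring

/-! ### Averages and self-normalised averages of i.i.d. samples. -/

section Empirical

variable {α Ω : Type*} [MeasurableSpace α] [MeasurableSpace Ω] {P : Measure Ω}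
  [IsProbabilityMeasure P] {μ : Measure α} {X : ℕ → Ω → α} {f : α → ℝ} {L : ℝ}

lemma memLp_comp_of_bounded (hX : ∀ i, AEMeasurable (X i) P) (hlaw : ∀ i, P.map (X i) = μ)
    (hf : Measurable f) (h0 : ∀ x, 0 ≤ f x) (hL : ∀ᵐ x ∂μ, f x ≤ L) (i : ℕ) :
    MemLp (f ∘ X i) 2 P := by
  refine MemLp.of_bound (hf.comp_aemeasurable (hX i)).aestronglyMeasurable L ?_
  have := ae_of_ae_map (hX i) ((hlaw i).symm ▸ hL)
  filter_upwards [this] with ω hω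
  simpa [Real.norm_eq_abs, abs_of_nonneg (h0 _)] using hω

omit [IsProbabilityMeasure P] in
lemma integral_comp_law (hX : ∀ i, AEMeasurable (X i) P) (hlaw : ∀ i, P.map (X i) = μ)
    (hf : Measurable f) (i : ℕ) : ∫ ω, f (X i ω) ∂P = ∫ x, f x ∂μ := by
  rw [← hlaw i, integral_map (hX i) hf.aestronglyMeasurable]

lemma variance_sum_comp_le (hX : ∀ i, AEMeasurable (X i) P) (hlaw : ∀ i, P.map (X i) = μ)
    (hindep : iIndepFun X P) (hf : Measurable f) (h0 : ∀ x, 0 ≤ f x)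
    (hL : ∀ᵐ x ∂μ, f x ≤ L) (s : Finset ℕ) :
    variance (∑ i ∈ s, f ∘ X i) P ≤ s.card * L ^ 2 := by
  rw [IndepFun.variance_sum (fun i _ => memLp_comp_of_bounded hX hlaw hf h0 hL i)
    (fun i _ j _ hij => (hindep.indepFun hij).comp hf hf), ← nsmul_eq_mul]
  refine Finset.sum_le_card_nsmul _ _ _ fun i _ => ?_
  have hb := ae_of_ae_map (hX i) ((hlaw i).symm ▸ hL)
  refine (variance_le_sq_of_bounded (a := 0) (b := L) ?_
    (hf.comp_aemeasurable (hX i))).trans ?_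
  · filter_upwards [hb] with ω hω using ⟨h0 _, hω⟩
  · nlinarith [sq_nonneg L]

lemma integral_sum_comp (hX : ∀ i, AEMeasurable (X i) P) (hlaw : ∀ i, P.map (X i) = μ)
    (hf : Measurable f) (h0 : ∀ x, 0 ≤ f x)
    (hL : ∀ᵐ x ∂μ, f x ≤ L) (s : Finset ℕ) :
    ∫ ω, (∑ i ∈ s, f ∘ X i) ω ∂P = s.card * ∫ x, f x ∂μ := by
  simp only [Finset.sum_apply]
  rw [integral_finsetSum s fun i _ =>
    (memLp_comp_of_bounded hX hlaw hf h0 hL i).integrable one_le_two]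
  simp only [Function.comp_apply, integral_comp_law hX hlaw hf, Finset.sum_const, nsmul_eq_mul]

lemma integral_abs_sub_le_sqrt_variance {Z : Ω → ℝ} (hZ : MemLp Z 2 P) :
    ∫ ω, |Z ω - ∫ ω', Z ω' ∂P| ∂P ≤ √(variance Z P) := by
  have hY : MemLp (fun ω => |Z ω - ∫ ω', Z ω' ∂P|) 2 P := (hZ.sub (memLp_const _)).abs
  -- Nonnegativity of the variance of `|Z - E Z|` is the inequality `(E|Z - E Z|)² ≤ Var Z`.
  have h1 := variance_eq_sub hY
  have h2 := variance_nonneg (fun ω => |Z ω - ∫ ω', Z ω' ∂P|) P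
  rw [h1] at h2
  refine Real.le_sqrt_of_sq_le ?_
  rw [variance_eq_integral hZ.aestronglyMeasurable.aemeasurable]
  simpa using h2

lemma lintegral_abs_average_sub_le (hX : ∀ i, AEMeasurable (X i) P)
    (hlaw : ∀ i, P.map (X i) = μ) (hindep : iIndepFun X P) (hf : Measurable f)
    (h0 : ∀ x, 0 ≤ f x) (hL : ∀ᵐ x ∂μ, f x ≤ L) (hL0 : 0 ≤ L) {n : ℕ} (hn : 0 < n) :
    ∫⁻ ω, ENNReal.ofReal |1 / (n : ℝ) * ∑ i ∈ Finset.range n, f (X i ω) - ∫ x, f x ∂μ| ∂P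
      ≤ ENNReal.ofReal (L / √n) := by
  have hn' : (0 : ℝ) < n := by exact_mod_cast hn
  set Z : Ω → ℝ := ∑ i ∈ Finset.range n, f ∘ X i with hZdef
  have hZ : MemLp Z 2 P := memLp_finsetSum' _ fun i _ => memLp_comp_of_bounded hX hlaw hf h0 hL i
  have hmean : ∫ ω, Z ω ∂P = n * ∫ x, f x ∂μ := by
    rw [hZdef, integral_sum_comp hX hlaw hf h0 hL, Finset.card_range]
  have hpt : ∀ ω, |1 / (n : ℝ) * ∑ i ∈ Finset.range n, f (X i ω) - ∫ x, f x ∂μ|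
      = 1 / (n : ℝ) * |Z ω - ∫ ω', Z ω' ∂P| := by
    intro ω
    rw [hmean, ← abs_of_pos (one_div_pos.2 hn'), ← abs_mul, abs_of_pos (one_div_pos.2 hn')]
    congr 1
    simp only [hZdef, Finset.sum_apply, Function.comp_apply]
    field_simp
  simp_rw [hpt]
  rw [← ofReal_integral_eq_lintegral_ofReal]
  · apply ENNReal.ofReal_le_ofReal
    rw [integral_const_mul]
    have h1 := integral_abs_sub_le_sqrt_variance hZ
    have h2 : √(variance Z P) ≤ √n * L := by
      rw [← Real.sqrt_sq hL0, ← Real.sqrt_mul hn'.le]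
      apply Real.sqrt_le_sqrt
      simpa using variance_sum_comp_le hX hlaw hindep hf h0 hL (Finset.range n)
    calc 1 / (n : ℝ) * ∫ ω, |Z ω - ∫ ω', Z ω' ∂P| ∂P ≤ 1 / (n : ℝ) * (√n * L) := by
          gcongr; exact h1.trans h2
      _ = L / √n := by
          have := Real.mul_self_sqrt hn'.le
          field_simp
          nlinarith [this]
  · exact (((hZ.sub (memLp_const _)).abs).integrable one_le_two).const_mul _
  · exact ae_of_all _ fun ω => by positivity

/-- Chebyshev: the sum without index `i` has mean `n - 1` and variance at most `(n - 1) L²`, and `n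
≥ 2` gives `n - 1 - n / 4 ≥ n / 4`. -/
lemma measure_sum_lt_le (hX : ∀ i, AEMeasurable (X i) P) (hlaw : ∀ i, P.map (X i) = μ)
    (hindep : iIndepFun X P) (hf : Measurable f) (h0 : ∀ x, 0 ≤ f x)
    (hL : ∀ᵐ x ∂μ, f x ≤ L) (h1 : ∫ x, f x ∂μ = 1) {n : ℕ} (hn : 2 ≤ n) {i : ℕ}
    (hi : i ∈ Finset.range n) :
    P {ω | ∑ j ∈ (Finset.range n).erase i, f (X j ω) < n / 4} ≤ ENNReal.ofReal (16 * L ^ 2 / n) := by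
  have hn' : (2 : ℝ) ≤ n := by exact_mod_cast hn
  set s := (Finset.range n).erase i
  have hs : (s.card : ℝ) = n - 1 := by
    rw [Finset.card_erase_of_mem hi, Finset.card_range, Nat.cast_sub (by omega), Nat.cast_one]
  have hZ : MemLp (∑ j ∈ s, f ∘ X j) 2 P :=
    memLp_finsetSum' _ fun j _ => memLp_comp_of_bounded hX hlaw hf h0 hL j
  have hmean := integral_sum_comp hX hlaw hf h0 hL s
  rw [h1, hs, mul_one] at hmean
  refine (measure_mono fun ω hω => ?_).trans
    ((meas_ge_le_variance_div_sq hZ (c := (n : ℝ) / 4) (by positivity)).trans ?_)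
  · simp only [Set.mem_ofPred_eq] at hω ⊢
    rw [hmean, Finset.sum_apply, abs_sub_comm]
    refine le_trans ?_ (le_abs_self _)
    simp only [Function.comp_apply]
    linarith
  · apply ENNReal.ofReal_le_ofReal
    have := variance_sum_comp_le hX hlaw hindep hf h0 hL s
    rw [hs] at this
    rw [div_le_div_iff₀ (by positivity) (by positivity)]
    nlinarith [sq_nonneg L]

/-- Self-normalised averages of a nonnegative function are controlled, up to the squared bound of
the density, by its mean. -/
lemma lintegral_selfNormalized_le (hX : ∀ i, AEMeasurable (X i) P)
    (hlaw : ∀ i, P.map (X i) = μ) (hindep : iIndepFun X P) (hf : Measurable f)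
    (h0 : ∀ x, 0 < f x) (hL : ∀ᵐ x ∂μ, f x ≤ L) (h1 : ∫ x, f x ∂μ = 1) (hL1 : 1 ≤ L)
    {n : ℕ} (hn : 2 ≤ n) {φ : α → ℝ≥0∞} (hφ : Measurable φ) :
    ∫⁻ ω, ∑ i ∈ Finset.range n,
        ENNReal.ofReal (f (X i ω) / ∑ j ∈ Finset.range n, f (X j ω)) * φ (X i ω) ∂P
      ≤ ENNReal.ofReal (20 * L ^ 2) * ∫⁻ x, φ x ∂μ := by
  have hn' : (0 : ℝ) < n := by positivity
  have hm : ∀ i, AEMeasurable (fun ω => f (X i ω)) P := fun i => hf.comp_aemeasurable (hX i)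
  have hmφ : ∀ i, AEMeasurable (fun ω => φ (X i ω)) P := fun i => hφ.comp_aemeasurable (hX i)
  rw [lintegral_finsetSum' _ fun i _ => by fun_prop]
  have hterm : ∀ i ∈ Finset.range n,
      ∫⁻ ω, ENNReal.ofReal (f (X i ω) / ∑ j ∈ Finset.range n, f (X j ω)) * φ (X i ω) ∂P
        ≤ ENNReal.ofReal (20 * L ^ 2 / n) * ∫⁻ x, φ x ∂μ := by
    intro i hi
    set s := (Finset.range n).erase i with hs
    -- Leave-one-out: the event that the other weights are too small depends only on the samples `j
    -- ≠ i`, hence is independent of `φ (X i)`. Off this event the normalised weight is at most `4 L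
    -- / n`; on it, the trivial bound 1 is used.
    let ψ : (s → α) → ℝ≥0∞ :=
      Set.indicator {v | ∑ j : s, f (v j) < n / 4} 1
    have hψm : Measurable ψ := by
      refine measurable_one.indicator (measurableSet_lt ?_ measurable_const)
      fun_prop
    let T : Ω → (s → α) := fun ω j => X j ω
    have hind : IndepFun (fun ω => φ (X i ω)) (fun ω => ψ (T ω)) P := by
      have := hindep.indepFun_finset₀ {i} s (by simp [hs]) hX
      exact this.comp (φ := fun u : ({i} : Finset ℕ) → α => φ (u ⟨i, by simp⟩))
        (hφ.comp (measurable_pi_apply _)) hψm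
    have hTm : AEMeasurable T P := aemeasurable_pi_lambda _ fun j => hX j
    have hψval : ∀ ω, ψ (T ω) = Set.indicator {ω | ∑ j ∈ s, f (X j ω) < n / 4} 1 ω := by
      intro ω
      simp only [ψ, T, Set.indicator_apply, Set.mem_ofPred_eq]
      rw [Finset.sum_coe_sort s fun j => f (X j ω)]
      rfl
    have hψint : ∫⁻ ω, ψ (T ω) ∂P ≤ ENNReal.ofReal (16 * L ^ 2 / n) := by
      simp_rw [hψval]
      have hnull : NullMeasurableSet {ω | ∑ j ∈ s, f (X j ω) < n / 4} P :=
        nullMeasurableSet_lt (by fun_prop) aemeasurable_const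
      rw [lintegral_indicator_one₀ hnull]
      exact measure_sum_lt_le hX hlaw hindep hf (fun x => (h0 x).le) hL h1 hn hi
    have hφint : ∫⁻ ω, φ (X i ω) ∂P = ∫⁻ x, φ x ∂μ := by
      rw [← hlaw i, lintegral_map' hφ.aemeasurable (hX i)]
    have hb := ae_of_ae_map (hX i) ((hlaw i).symm ▸ hL)
    calc ∫⁻ ω, ENNReal.ofReal (f (X i ω) / ∑ j ∈ Finset.range n, f (X j ω)) * φ (X i ω) ∂P
        ≤ ∫⁻ ω, (ENNReal.ofReal (4 * L / n) * φ (X i ω) + φ (X i ω) * ψ (T ω)) ∂P := by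
          refine lintegral_mono_ae ?_
          filter_upwards [hb] with ω hω
          rw [mul_comm (φ (X i ω)), ← add_mul]
          gcongr
          rw [← Finset.add_sum_erase _ (fun j => f (X j ω)) hi, ← hs, hψval]
          have hS : 0 ≤ ∑ j ∈ s, f (X j ω) := Finset.sum_nonneg fun j _ => (h0 _).le
          have hpos := h0 (X i ω)
          by_cases hlt : ∑ j ∈ s, f (X j ω) < n / 4
          · rw [Set.indicator_of_mem (by exact hlt)]
            refine le_add_left ?_
            rw [Pi.one_apply]
            refine ENNReal.ofReal_le_one.2 ?_
            rw [div_le_one (by positivity)]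
            linarith
          · refine le_add_right (ENNReal.ofReal_le_ofReal ?_)
            rw [not_lt] at hlt
            rw [div_le_div_iff₀ (by positivity) hn']
            nlinarith
      _ = ENNReal.ofReal (4 * L / n) * ∫⁻ x, φ x ∂μ + (∫⁻ x, φ x ∂μ) * ∫⁻ ω, ψ (T ω) ∂P := by
          rw [lintegral_add_left' (by fun_prop), lintegral_const_mul'' _ (hmφ i), hφint,
            lintegral_mul_eq_lintegral_mul_lintegral_of_indepFun'' (g := fun ω => ψ (T ω)) (hmφ i)
              (hψm.comp_aemeasurable hTm) hind, hφint]
      _ ≤ ENNReal.ofReal (4 * L / n) * ∫⁻ x, φ x ∂μ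
            + (∫⁻ x, φ x ∂μ) * ENNReal.ofReal (16 * L ^ 2 / n) := by gcongr
      _ = ENNReal.ofReal (4 * L / n + 16 * L ^ 2 / n) * ∫⁻ x, φ x ∂μ := by
          rw [ENNReal.ofReal_add (by positivity) (by positivity)]; ring
      _ ≤ _ := by
          gcongr ENNReal.ofReal ?_ * _
          rw [← add_div]
          gcongr
          -- `4 L + 16 L² ≤ 20 L²` because `L ≥ 1`.
          nlinarith
  refine (Finset.sum_le_card_nsmul _ _ _ hterm).trans (le_of_eq ?_)
  rw [Finset.card_range, nsmul_eq_mul, ← mul_assoc, ← ENNReal.ofReal_natCast,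
    ← ENNReal.ofReal_mul hn'.le]
  congr 2
  field_simp

end Empirical

/-! ### The tilt and its density. -/

variable {d : ℕ} {gmax : ℝ} {μ : Measure (Space d)} {g : Space d → Space d}

/-- The density of the tilt with respect to the base measure. -/
noncomputable def tiltDensity (μ : Measure (Space d)) (g : Space d → Space d) (θ x : Space d) : ℝ :=
  weight g θ x / tiltMass μ g θ

lemma measurable_weight (hg : Measurable g) (θ : Space d) : Measurable (weight g θ) := by
  unfold weight
  fun_prop

lemma weight_pos (g : Space d → Space d) (θ x : Space d) : 0 < weight g θ x := Real.exp_pos _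

lemma abs_inner_le (hgmax : ∀ᵐ x ∂μ, ‖g x‖ ≤ gmax) (θ : Space d) :
    ∀ᵐ x ∂μ, |inner ℝ θ (g x)| ≤ ‖θ‖ * gmax := by
  filter_upwards [hgmax] with x hx
  exact (abs_real_inner_le_norm _ _).trans (by gcongr)

lemma integrable_weight [IsProbabilityMeasure μ] (hg : Measurable g)
    (hgmax : ∀ᵐ x ∂μ, ‖g x‖ ≤ gmax) (θ : Space d) : Integrable (weight g θ) μ := by
  refine Integrable.of_bound (measurable_weight hg θ).aestronglyMeasurable
    (Real.exp (‖θ‖ * gmax)) ?_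
  filter_upwards [abs_inner_le hgmax θ] with x hx
  rw [Real.norm_eq_abs, abs_of_pos (weight_pos g θ x)]
  exact Real.exp_le_exp.2 ((le_abs_self _).trans hx)

lemma tiltMass_pos [IsProbabilityMeasure μ] (hg : Measurable g)
    (hgmax : ∀ᵐ x ∂μ, ‖g x‖ ≤ gmax) (θ : Space d) : 0 < tiltMass μ g θ :=
  integral_exp_pos (integrable_weight hg hgmax θ)

lemma measurable_tiltDensity (hg : Measurable g) (θ : Space d) :
    Measurable (tiltDensity μ g θ) :=
  (measurable_weight hg θ).div_const _

lemma tiltDensity_pos [IsProbabilityMeasure μ] (hg : Measurable g)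
    (hgmax : ∀ᵐ x ∂μ, ‖g x‖ ≤ gmax) (θ x : Space d) : 0 < tiltDensity μ g θ x :=
  div_pos (weight_pos g θ x) (tiltMass_pos hg hgmax θ)

lemma integral_tiltDensity [IsProbabilityMeasure μ] (hg : Measurable g)
    (hgmax : ∀ᵐ x ∂μ, ‖g x‖ ≤ gmax) (θ : Space d) : ∫ x, tiltDensity μ g θ x ∂μ = 1 := by
  unfold tiltDensity
  rw [integral_div]
  exact div_self (tiltMass_pos hg hgmax θ).ne'

lemma isProbabilityMeasure_tiltedLaw [IsProbabilityMeasure μ] (hg : Measurable g)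
    (hgmax : ∀ᵐ x ∂μ, ‖g x‖ ≤ gmax) (θ : Space d) :
    IsProbabilityMeasure (tiltedLaw μ g θ) :=
  isProbabilityMeasure_tilted (integrable_weight hg hgmax θ)

lemma lintegral_tiltedLaw (θ : Space d) (φ : Space d → ℝ≥0∞) :
    ∫⁻ x, φ x ∂(tiltedLaw μ g θ) = ∫⁻ x, ENNReal.ofReal (tiltDensity μ g θ x) * φ x ∂μ :=
  lintegral_tilted _ _

lemma tiltedLaw_real [IsProbabilityMeasure μ] (hg : Measurable g)
    (hgmax : ∀ᵐ x ∂μ, ‖g x‖ ≤ gmax) (θ : Space d) {A : Set (Space d)} (hA : MeasurableSet A) :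
    (tiltedLaw μ g θ).real A = ∫ x, A.indicator (tiltDensity μ g θ) x ∂μ := by
  rw [integral_indicator hA, measureReal_def, tiltedLaw, tilted_apply_eq_ofReal_integral' _ hA,
    ENNReal.toReal_ofReal]
  · rfl
  · exact integral_nonneg fun x => (tiltDensity_pos hg hgmax θ x).le

/-! ### The plug-in measure in terms of the density. -/

section PlugIn

variable [IsProbabilityMeasure μ] (hg : Measurable g) (hgmax : ∀ᵐ x ∂μ, ‖g x‖ ≤ gmax)
  (θ : Space d) {n : ℕ} (hn : 0 < n) (x : ℕ → Space d)

include hg hgmax hn in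
lemma plugIn_eq_tiltDensity :
    plugIn g θ n x = ∑ i ∈ Finset.range n, ENNReal.ofReal
      (tiltDensity μ g θ (x i) / ∑ j ∈ Finset.range n, tiltDensity μ g θ (x j)) •
        Measure.dirac (x i) := by
  have hM := tiltMass_pos (μ := μ) hg hgmax θ
  have hn' : (0 : ℝ) < n := by exact_mod_cast hn
  have hS : 0 < ∑ j ∈ Finset.range n, weight g θ (x j) :=
    Finset.sum_pos (fun _ _ => weight_pos g θ _) (Finset.nonempty_range_iff.2 hn.ne')
  unfold plugIn averageWeight
  refine Finset.sum_congr rfl fun i _ => ?_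
  congr 2
  unfold tiltDensity
  rw [← Finset.sum_div]
  field_simp

include hg hgmax hn in
lemma sum_tiltDensity_pos : 0 < ∑ j ∈ Finset.range n, tiltDensity μ g θ (x j) :=
  Finset.sum_pos (fun _ _ => tiltDensity_pos hg hgmax θ _) (Finset.nonempty_range_iff.2 hn.ne')

include hg hgmax hn in
lemma plugIn_real {A : Set (Space d)} (hA : MeasurableSet A) :
    (plugIn g θ n x).real A = (∑ i ∈ Finset.range n, A.indicator (tiltDensity μ g θ) (x i)) /
      ∑ j ∈ Finset.range n, tiltDensity μ g θ (x j) := by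
  have hS := sum_tiltDensity_pos (μ := μ) hg hgmax θ hn x
  rw [plugIn_eq_tiltDensity (μ := μ) hg hgmax θ hn x, measureReal_def, Measure.finsetSum_apply,
    ENNReal.toReal_sum, Finset.sum_div]
  · refine Finset.sum_congr rfl fun i _ => ?_
    have := tiltDensity_pos (μ := μ) hg hgmax θ (x i)
    rw [Measure.smul_apply, Measure.dirac_apply' _ hA]
    by_cases h : x i ∈ A
    · simp [h]
      positivity
    · simp [h]
  · intro i _
    rw [Measure.smul_apply, smul_eq_mul]
    exact ENNReal.mul_ne_top ENNReal.ofReal_ne_top (measure_ne_top _ _)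

include hg hgmax hn in
lemma isProbabilityMeasure_plugIn : IsProbabilityMeasure (plugIn g θ n x) := by
  have hS := sum_tiltDensity_pos (μ := μ) hg hgmax θ hn x
  have h := plugIn_real (μ := μ) hg hgmax θ hn x MeasurableSet.univ
  rw [Set.indicator_univ, div_self hS.ne', measureReal_def] at h
  exact ⟨(ENNReal.toReal_eq_one_iff _).1 h⟩

include hg hgmax hn in
-- With `ν = a / S`, one has `ν - b = (a / n - b) - ν (S / n - 1)` and `ν ≤ 1`, so no lower bound on
-- the random normaliser `S` is needed.
lemma abs_plugIn_real_sub_le {A : Set (Space d)} (hA : MeasurableSet A) (b : ℝ) :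
    |(plugIn g θ n x).real A - b| ≤
      |1 / (n : ℝ) * ∑ i ∈ Finset.range n, A.indicator (tiltDensity μ g θ) (x i) - b|
      + |1 / (n : ℝ) * ∑ i ∈ Finset.range n, tiltDensity μ g θ (x i) - 1| := by
  have hn' : (0 : ℝ) < n := by exact_mod_cast hn
  have hS := sum_tiltDensity_pos (μ := μ) hg hgmax θ hn x
  have := isProbabilityMeasure_plugIn (μ := μ) hg hgmax θ hn x
  have h1 : (plugIn g θ n x).real A ≤ 1 := measureReal_le_one
  have h2 := plugIn_real (μ := μ) hg hgmax θ hn x hA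
  set a := ∑ i ∈ Finset.range n, A.indicator (tiltDensity μ g θ) (x i)
  set S := ∑ i ∈ Finset.range n, tiltDensity μ g θ (x i)
  set ν := (plugIn g θ n x).real A
  have h3 : a = ν * S := by rw [h2]; field_simp
  have h4 : ν - b = (1 / (n : ℝ) * a - b) - ν * (1 / (n : ℝ) * S - 1) := by rw [h3]; ring
  rw [h4, sub_eq_add_neg (_ - b)]
  refine (abs_add_le _ _).trans ?_
  refine add_le_add le_rfl ?_
  rw [abs_neg, abs_mul, abs_of_nonneg (measureReal_nonneg : 0 ≤ ν)]
  exact mul_le_of_le_one_left (abs_nonneg _) h1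

include hg hgmax hn in
lemma lintegral_plugIn {φ : Space d → ℝ≥0∞} (hφ : Measurable φ) :
    ∫⁻ y, φ y ∂(plugIn g θ n x) = ∑ i ∈ Finset.range n, ENNReal.ofReal
      (tiltDensity μ g θ (x i) / ∑ j ∈ Finset.range n, tiltDensity μ g θ (x j)) * φ (x i) := by
  rw [plugIn_eq_tiltDensity (μ := μ) hg hgmax θ hn x, lintegral_finsetSum_measure]
  refine Finset.sum_congr rfl fun i _ => ?_
  rw [lintegral_smul_measure, lintegral_dirac' _ hφ, smul_eq_mul]

end PlugIn

lemma one_le_of_tiltDensity_le [IsProbabilityMeasure μ] (hg : Measurable g)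
    (hgmax : ∀ᵐ x ∂μ, ‖g x‖ ≤ gmax) (θ : Space d) {L : ℝ}
    (hL : ∀ᵐ x ∂μ, tiltDensity μ g θ x ≤ L) : 1 ≤ L := by
  have h := integral_mono_ae ((integrable_weight hg hgmax θ).div_const _)
    (integrable_const L) hL
  have h1 := integral_tiltDensity hg hgmax θ
  unfold tiltDensity at h1
  rw [h1] at h
  simpa using h

/-! ### The nonasymptotic bound for a bounded density. -/

/-- Nonasymptotic bound on the expected transport cost of the plug-in estimator. -/
theorem lintegral_transportCost_le [IsProbabilityMeasure μ] (hg : Measurable g)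
    (hgmax : ∀ᵐ x ∂μ, ‖g x‖ ≤ gmax) (θ : Space d) {L : ℝ}
    (hL : ∀ᵐ x ∂μ, tiltDensity μ g θ x ≤ L)
    {Ω : Type*} [MeasurableSpace Ω] {P : Measure Ω} [IsProbabilityMeasure P]
    {X : ℕ → Ω → Space d} (hX : ∀ i, AEMeasurable (X i) P)
    (hlaw : ∀ i, P.map (X i) = μ) (hindep : iIndepFun X P) {n : ℕ} (hn : 2 ≤ n)
    {p : ℝ} (hp : 0 ≤ p) {ι : Type*} (s : Finset ι)
    {A : ι → Set (Space d)} (hA : ∀ k, MeasurableSet (A k))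
    (hd : (s : Set ι).PairwiseDisjoint A) {B r : ℝ≥0∞}
    (hB : ∀ k ∈ s, ∀ x ∈ A k, ‖x‖ₑ ≤ B) (hr : ∀ k ∈ s, ∀ x ∈ A k, ∀ y ∈ A k, ‖x - y‖ₑ ≤ r) :
    ∫⁻ ω, transportCost p (plugIn g θ n fun i => X i ω) (tiltedLaw μ g θ) ∂P ≤
      r ^ p + 2 ^ p * (2 * B ^ p * (s.card * ENNReal.ofReal (2 * L / √n)) +
        ENNReal.ofReal (21 * L ^ 2) * ∫⁻ x in (⋃ k ∈ s, A k)ᶜ, ‖x‖ₑ ^ p ∂μ) := by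
  have hn0 : 0 < n := by omega
  have hL1 := one_le_of_tiltDensity_le hg hgmax θ hL
  have hL0 : 0 ≤ L := by linarith
  have hmD := measurable_tiltDensity (μ := μ) hg θ
  have hD0 := tiltDensity_pos (μ := μ) hg hgmax θ
  have := isProbabilityMeasure_tiltedLaw hg hgmax θ
  set C := (⋃ k ∈ s, A k)ᶜ with hCdef
  have hC : MeasurableSet C := (s.measurableSet_biUnion fun k _ => hA k).compl
  set φ : Space d → ℝ≥0∞ := C.indicator fun x => ‖x‖ₑ ^ p with hφdef
  have hφ : Measurable φ := Measurable.indicator (by fun_prop) hC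
  have hφint : ∀ ν : Measure (Space d), ∫⁻ x in C, ‖x‖ₑ ^ p ∂ν = ∫⁻ x, φ x ∂ν := fun ν =>
    (lintegral_indicator hC _).symm
  let avg : (Space d → ℝ) → Ω → ℝ := fun f ω =>
    1 / (n : ℝ) * ∑ i ∈ Finset.range n, f (X i ω)
  -- `U k` collects the fluctuation of cell `k` and of the normaliser, each of mean at most `L /
  -- √n`; `W` is the tail of the plug-in measure.
  let U : ι → Ω → ℝ≥0∞ := fun k ω =>
    ENNReal.ofReal |avg ((A k).indicator (tiltDensity μ g θ)) ω -
      ∫ x, (A k).indicator (tiltDensity μ g θ) x ∂μ|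
      + ENNReal.ofReal |avg (tiltDensity μ g θ) ω - ∫ x, tiltDensity μ g θ x ∂μ|
  let W : Ω → ℝ≥0∞ := fun ω => ∑ i ∈ Finset.range n, ENNReal.ofReal
    (tiltDensity μ g θ (X i ω) / ∑ j ∈ Finset.range n, tiltDensity μ g θ (X j ω)) * φ (X i ω)
  have havg : ∀ {f : Space d → ℝ}, Measurable f → AEMeasurable (avg f) P := by
    intro f hf
    have : ∀ i, AEMeasurable (fun ω => f (X i ω)) P := fun i => hf.comp_aemeasurable (hX i)
    fun_prop
  have hUm : ∀ k, AEMeasurable (U k) P := by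
    intro k
    have h1 := havg (hmD.indicator (hA k))
    have h2 := havg hmD
    fun_prop
  have hpt : ∀ ω, transportCost p (plugIn g θ n fun i => X i ω) (tiltedLaw μ g θ) ≤
      r ^ p + 2 ^ p * (2 * B ^ p * ∑ k ∈ s, U k ω + (W ω + ∫⁻ x, φ x ∂(tiltedLaw μ g θ))) := by
    intro ω
    have := isProbabilityMeasure_plugIn (μ := μ) hg hgmax θ hn0 fun i => X i ω
    refine (transportCost_le_cells hp s hA hd hB hr _ _).trans ?_
    rw [hφint, hφint, lintegral_plugIn (μ := μ) hg hgmax θ hn0 _ hφ]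
    gcongr with k _
    rw [tiltedLaw_real hg hgmax θ (hA k)]
    refine (ENNReal.ofReal_le_ofReal
      (abs_plugIn_real_sub_le (μ := μ) hg hgmax θ hn0 _ (hA k) _)).trans ?_
    rw [ENNReal.ofReal_add (abs_nonneg _) (abs_nonneg _)]
    simp only [U, avg, integral_tiltDensity hg hgmax θ]
    exact le_rfl
  have hU : ∀ k, ∫⁻ ω, U k ω ∂P ≤ ENNReal.ofReal (2 * L / √n) := by
    intro k
    have hLk : ∀ᵐ x ∂μ, (A k).indicator (tiltDensity μ g θ) x ≤ L := by
      filter_upwards [hL] with x hx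
      by_cases h : x ∈ A k <;> simp [h, hx, hL0]
    have h1 := lintegral_abs_average_sub_le hX hlaw hindep (hmD.indicator (hA k))
      (fun x => Set.indicator_nonneg (fun x _ => (hD0 x).le) x) hLk hL0 hn0
    have h2 := lintegral_abs_average_sub_le hX hlaw hindep hmD (fun x => (hD0 x).le) hL hL0 hn0
    have hm1 := havg (hmD.indicator (hA k))
    calc ∫⁻ ω, U k ω ∂P = _ := lintegral_add_left' (by fun_prop) _
      _ ≤ _ := add_le_add h1 h2
      _ = _ := by
        rw [← ENNReal.ofReal_add (by positivity) (by positivity)]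
        congr 1
        ring
  have hW : ∫⁻ ω, W ω ∂P ≤ ENNReal.ofReal (20 * L ^ 2) * ∫⁻ x, φ x ∂μ :=
    lintegral_selfNormalized_le hX hlaw hindep hmD hD0 hL (integral_tiltDensity hg hgmax θ) hL1
      hn hφ
  -- `L ≤ L²` puts this tail in the same form as that of `W`, and `20 + 1 = 21`.
  have hT : ∫⁻ x, φ x ∂(tiltedLaw μ g θ) ≤ ENNReal.ofReal (L ^ 2) * ∫⁻ x, φ x ∂μ := by
    rw [lintegral_tiltedLaw, ← lintegral_const_mul _ hφ]
    refine lintegral_mono_ae ?_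
    filter_upwards [hL] with x hx
    gcongr
    nlinarith
  rw [hφint]
  calc _ ≤ ∫⁻ ω, (r ^ p + 2 ^ p * (2 * B ^ p * ∑ k ∈ s, U k ω +
            (W ω + ∫⁻ x, φ x ∂(tiltedLaw μ g θ)))) ∂P := lintegral_mono hpt
    _ = r ^ p + 2 ^ p * (2 * B ^ p * ∑ k ∈ s, ∫⁻ ω, U k ω ∂P +
            (∫⁻ ω, W ω ∂P + ∫⁻ x, φ x ∂(tiltedLaw μ g θ))) := by
        have hs : AEMeasurable (fun ω => ∑ k ∈ s, U k ω) P := by fun_prop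
        have h2p : (2 : ℝ≥0∞) ^ p ≠ ∞ := by finiteness
        rw [lintegral_add_left measurable_const, lintegral_const, measure_univ, mul_one,
          lintegral_const_mul' _ _ h2p, lintegral_add_left' (hs.const_mul _),
          lintegral_const_mul'' _ hs, lintegral_finsetSum' _ fun k _ => hUm k,
          lintegral_add_right _ measurable_const, lintegral_const, measure_univ, mul_one]
    _ ≤ r ^ p + 2 ^ p * (2 * B ^ p * (s.card * ENNReal.ofReal (2 * L / √n)) +
            (ENNReal.ofReal (20 * L ^ 2) * ∫⁻ x, φ x ∂μ
              + ENNReal.ofReal (L ^ 2) * ∫⁻ x, φ x ∂μ)) := by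
        gcongr
        rw [← nsmul_eq_mul]
        exact Finset.sum_le_card_nsmul _ _ _ fun k _ => hU k
    _ = _ := by
        rw [← add_mul, ← ENNReal.ofReal_add (by positivity) (by positivity)]
        congr 5
        ring

/-! ### Density growth and the consequences of the limit hypothesis. -/

/-- The density of the tilt grows subexponentially at any prescribed rate, uniformly in the
direction of `θ`. -/
lemma exists_tiltDensity_le [IsProbabilityMeasure μ] (hg : Measurable g)
    (hgmax : ∀ᵐ x ∂μ, ‖g x‖ ≤ gmax) {δ : ℝ} (hδ : 0 < δ) :
    ∃ C : ℝ, 0 ≤ C ∧ ∀ θ, ∀ᵐ x ∂μ, tiltDensity μ g θ x ≤ C * Real.exp (δ * ‖θ‖) := by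
  obtain ⟨t, -, htfin, hcover⟩ :=
    (isCompact_closedBall (0 : Space d) gmax).finite_cover_balls (half_pos hδ)
  lift t to Finset (Space d) using htfin
  let G : Space d → Set (Space d) := fun y => g ⁻¹' Metric.ball y (δ / 2)
  -- Null preimages add `0⁻¹ = 0` to the constant; almost every point lies in none of them.
  refine ⟨∑ y ∈ t, (μ.real (G y))⁻¹, Finset.sum_nonneg fun y _ => by positivity, fun θ => ?_⟩
  have hnull : ∀ᵐ x ∂μ, ∀ y ∈ t, μ (G y) = 0 → x ∉ G y := by
    rw [Finset.eventually_all t]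
    intro y _
    by_cases h : μ (G y) = 0
    · filter_upwards [measure_eq_zero_iff_ae_notMem.1 h] with x hx _ using hx
    · exact ae_of_all _ fun x h' => absurd h' h
  filter_upwards [hgmax, hnull] with x hx hxn
  obtain ⟨y, hy, hxy⟩ : ∃ y ∈ t, x ∈ G y := by
    have := hcover (mem_closedBall_zero_iff.2 hx)
    simpa [G] using this
  have hpos : 0 < μ.real (G y) := by
    rw [measureReal_def]
    exact ENNReal.toReal_pos (fun h => hxn y hy h hxy) (measure_ne_top _ _)
  have hM := tiltMass_pos hg hgmax θ
  -- On `G y` the values of `g` differ by at most `δ`, so the weights there are at least `e^{-δ‖θ‖}`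
  -- times the weight at `x`.
  have hlow : weight g θ x * Real.exp (-(δ * ‖θ‖)) * μ.real (G y) ≤ tiltMass μ g θ := by
    have hGm : MeasurableSet (G y) := hg measurableSet_ball
    have hw := integrable_weight hg hgmax θ
    calc weight g θ x * Real.exp (-(δ * ‖θ‖)) * μ.real (G y)
        = ∫ _ in G y, weight g θ x * Real.exp (-(δ * ‖θ‖)) ∂μ := by
          rw [setIntegral_const, smul_eq_mul, mul_comm]
      _ ≤ ∫ z in G y, weight g θ z ∂μ := by
          refine setIntegral_mono_on (integrable_const _) hw.integrableOn hGm fun z hz => ?_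
          unfold weight
          rw [← Real.exp_add]
          refine Real.exp_le_exp.2 ?_
          have h1 : dist (g x) (g z) ≤ δ := by
            have hx' : dist (g x) y < δ / 2 := hxy
            have hz' : dist (g z) y < δ / 2 := hz
            linarith [dist_triangle_right (g x) (g z) y]
          have h2 : inner ℝ θ (g x) - inner ℝ θ (g z) ≤ ‖θ‖ * δ := by
            rw [← inner_sub_right]
            refine (real_inner_le_norm _ _).trans ?_
            rw [dist_eq_norm] at h1
            gcongr
          linarith
      _ ≤ _ := setIntegral_le_integral hw (ae_of_all _ fun z => (weight_pos g θ z).le)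
  have hsum : (μ.real (G y))⁻¹ ≤ ∑ y ∈ t, (μ.real (G y))⁻¹ :=
    Finset.single_le_sum (f := fun y => (μ.real (G y))⁻¹) (fun y _ => by positivity) hy
  refine le_trans ?_ (mul_le_mul_of_nonneg_right hsum (Real.exp_pos _).le)
  unfold tiltDensity
  rw [div_le_iff₀ hM]
  calc weight g θ x = (μ.real (G y))⁻¹ * Real.exp (δ * ‖θ‖) *
        (weight g θ x * Real.exp (-(δ * ‖θ‖)) * μ.real (G y)) := by
        rw [Real.exp_neg]
        field_simp
    _ ≤ _ := by gcongr

lemma integrable_of_norm_le [IsProbabilityMeasure μ] (hg : Measurable g)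
    (hgmax : ∀ᵐ x ∂μ, ‖g x‖ ≤ gmax) : Integrable g μ :=
  Integrable.of_bound hg.aestronglyMeasurable gmax hgmax

/-- Jensen's inequality, obtained from the tangent line of `exp` at `m`, followed by Cauchy–Schwarz.
-/
lemma exp_neg_le_tiltMass [IsProbabilityMeasure μ] (hg : Measurable g)
    (hgmax : ∀ᵐ x ∂μ, ‖g x‖ ≤ gmax) (θ : Space d) :
    Real.exp (-(‖θ‖ * ‖∫ x, g x ∂μ‖)) ≤ tiltMass μ g θ := by
  have hgi := integrable_of_norm_le hg hgmax
  have hi : Integrable (fun x => inner ℝ θ (g x)) μ := hgi.const_inner θ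
  have hmean : ∫ x, inner ℝ θ (g x) ∂μ = inner ℝ θ (∫ x, g x ∂μ) := integral_inner hgi θ
  set m := inner ℝ θ (∫ x, g x ∂μ)
  have hi' : Integrable (fun x => inner ℝ θ (g x) - m) μ := hi.sub (integrable_const _)
  have h1 : Real.exp m ≤ tiltMass μ g θ := by
    calc Real.exp m = ∫ x, Real.exp m * (1 + (inner ℝ θ (g x) - m)) ∂μ := by
          rw [integral_const_mul, integral_add (integrable_const _) hi',
            integral_sub hi (integrable_const _), hmean]
          simp
      _ ≤ tiltMass μ g θ := by
          refine integral_mono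
            (((integrable_const _).add hi').const_mul _)
            (integrable_weight hg hgmax θ) fun x => ?_
          have h2 := Real.add_one_le_exp (inner ℝ θ (g x) - m)
          calc Real.exp m * (1 + (inner ℝ θ (g x) - m))
              ≤ Real.exp m * Real.exp (inner ℝ θ (g x) - m) := by gcongr; linarith
            _ = weight g θ x := by rw [← Real.exp_add, add_sub_cancel]; rfl
  refine le_trans (Real.exp_le_exp.2 ?_) h1
  exact (abs_le.1 (abs_real_inner_le_norm θ (∫ x, g x ∂μ))).1

/-- If the mean `m` had norm at least `gmax`, then `‖g - m‖² ≤ 2‖m‖² - 2⟪m, g⟫` a.e., and the right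
side integrates to zero, forcing `g = m` a.e. -/
lemma norm_integral_lt [IsProbabilityMeasure μ] (hg : Measurable g)
    (hgmax : ∀ᵐ x ∂μ, ‖g x‖ ≤ gmax) (hconst : ¬ ∃ v, ∀ᵐ x ∂μ, g x = v) :
    ‖∫ x, g x ∂μ‖ < gmax := by
  by_contra! h
  refine hconst ⟨∫ x, g x ∂μ, ?_⟩
  have hgi := integrable_of_norm_le hg hgmax
  set m := ∫ x, g x ∂μ with hm
  have hbound : ∀ᵐ x ∂μ, ‖g x - m‖ ^ 2 ≤ 2 * ‖m‖ ^ 2 - 2 * inner ℝ m (g x) := by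
    filter_upwards [hgmax] with x hx
    rw [norm_sub_sq_real, real_inner_comm]
    nlinarith [norm_nonneg (g x), norm_nonneg m]
  have hint : Integrable (fun x => 2 * ‖m‖ ^ 2 - 2 * inner ℝ m (g x)) μ :=
    (integrable_const _).sub ((hgi.const_inner m).const_mul 2)
  have hzero : ∫ x, (2 * ‖m‖ ^ 2 - 2 * inner ℝ m (g x)) ∂μ = 0 := by
    rw [integral_sub (integrable_const _) ((hgi.const_inner m).const_mul 2), integral_const_mul,
      integral_const_mul, integral_inner hgi, ← hm, real_inner_self_eq_norm_sq]
    simp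
  have hae := (integral_eq_zero_iff_of_nonneg_ae
    (hbound.mono fun x hx => (sq_nonneg _).trans hx) hint).1 hzero
  filter_upwards [hbound, hae] with x h1 h2
  rw [h2] at h1
  have : ‖g x - m‖ = 0 := by
    have h3 : ‖g x - m‖ ^ 2 ≤ 0 := h1
    nlinarith [norm_nonneg (g x - m)]
  exact sub_eq_zero.1 (norm_eq_zero.1 this)

/-- Integrate `2 M w - M² ≤ w²`, using that the weight at `2θ` is `w²`. -/
lemma sq_tiltMass_le [IsProbabilityMeasure μ] (hg : Measurable g)
    (hgmax : ∀ᵐ x ∂μ, ‖g x‖ ≤ gmax) (θ : Space d) :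
    tiltMass μ g θ ^ 2 ≤ tiltMass μ g ((2 : ℝ) • θ) := by
  have hw := integrable_weight hg hgmax θ
  set M := tiltMass μ g θ with hM
  calc M ^ 2 = ∫ x, (2 * M * weight g θ x - M ^ 2) ∂μ := by
        rw [integral_sub (hw.const_mul _) (integrable_const _), integral_const_mul]
        simp only [integral_const, probReal_univ, one_smul]
        rw [← tiltMass, ← hM]
        ring
    _ ≤ tiltMass μ g ((2 : ℝ) • θ) := by
        refine integral_mono ((hw.const_mul _).sub (integrable_const _))
          (integrable_weight hg hgmax _) fun x => ?_
        have : weight g ((2 : ℝ) • θ) x = weight g θ x ^ 2 := by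
          unfold weight
          rw [real_inner_smul_left, ← Real.exp_nat_mul]
          norm_num
        simp only [this]
        nlinarith [sq_nonneg (weight g θ x - M)]

lemma le_growthFactor [IsProbabilityMeasure μ] (hg : Measurable g)
    (hgmax : ∀ᵐ x ∂μ, ‖g x‖ ≤ gmax) (θ : Space d) :
    Real.exp (‖θ‖ * gmax) * tiltMass μ g θ ≤ growthFactor μ g gmax θ := by
  have hM := tiltMass_pos hg hgmax θ
  unfold growthFactor
  rw [le_div_iff₀ hM, mul_assoc, ← sq]
  gcongr
  exact sq_tiltMass_le hg hgmax θ

/-- Pointwise, `e^{‖θ‖ gmax} M(θ)` times the density is `e^{‖θ‖ gmax + ⟪θ, g x⟫}`, which is at least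
1 a.e. -/
lemma absMoment_le_tiltedLaw [IsProbabilityMeasure μ] (hg : Measurable g)
    (hgmax : ∀ᵐ x ∂μ, ‖g x‖ ≤ gmax) (θ : Space d) (q : ℝ) :
    absMoment q μ ≤ ENNReal.ofReal (Real.exp (‖θ‖ * gmax) * tiltMass μ g θ) *
      absMoment q (tiltedLaw μ g θ) := by
  have hM := tiltMass_pos hg hgmax θ
  unfold absMoment
  rw [lintegral_tiltedLaw, ← lintegral_const_mul' _ _ ENNReal.ofReal_ne_top]
  refine lintegral_mono_ae ?_
  filter_upwards [abs_inner_le hgmax θ] with x hx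
  rw [← mul_assoc, ← ENNReal.ofReal_mul (by positivity)]
  refine le_mul_of_one_le_left' (ENNReal.one_le_ofReal.2 ?_)
  unfold tiltDensity weight
  rw [mul_div_assoc', mul_right_comm, mul_div_cancel_right₀ _ hM.ne', ← Real.exp_add]
  exact Real.one_le_exp (by linarith [(abs_le.1 hx).1])

/-- A vanishing moment concentrates `μ` at the origin, where `g` takes the single value `g 0`. -/
lemma absMoment_ne_zero [IsProbabilityMeasure μ] {q : ℝ} (hq : 0 < q)
    (hconst : ¬ ∃ v, ∀ᵐ x ∂μ, g x = v) : absMoment q μ ≠ 0 := by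
  intro h
  refine hconst ⟨g 0, ?_⟩
  rw [absMoment, lintegral_eq_zero_iff (by fun_prop)] at h
  filter_upwards [h] with x hx
  have : ‖x‖ₑ = 0 := by simpa [hq, hq.le, not_lt.2 hq.le] using hx
  rw [enorm_eq_zero.1 this]

lemma tiltDensity_eq_one_of_const [IsProbabilityMeasure μ] {v : Space d}
    (hv : ∀ᵐ x ∂μ, g x = v) (θ : Space d) : ∀ᵐ x ∂μ, tiltDensity μ g θ x = 1 := by
  have hw : ∀ᵐ x ∂μ, weight g θ x = Real.exp (inner ℝ θ v) := by
    filter_upwards [hv] with x hx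
    rw [weight, hx]
  have hM : tiltMass μ g θ = Real.exp (inner ℝ θ v) := by
    rw [tiltMass, integral_congr_ae hw]
    simp
  filter_upwards [hw] with x hx
  rw [tiltDensity, hx, hM, div_self (Real.exp_pos _).ne']

section Sequence

variable {p q : ℝ} {θ : ℕ → Space d} [IsProbabilityMeasure μ]

lemma absMoment_ne_top (hp : 0 < p) (hpq : p < q) (hg : Measurable g)
    (hgmax : ∀ᵐ x ∂μ, ‖g x‖ ≤ gmax)
    (hlim : Tendsto (fun N : ℕ => absMoment q (tiltedLaw μ g (θ N)) ^ (p / q) *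
      ENNReal.ofReal (growthFactor μ g gmax (θ N) * (N : ℝ) ^ (-p / (d : ℝ)) +
        (N : ℝ) ^ (-(1 / 2 : ℝ)))) atTop (𝓝 0)) :
    absMoment q μ ≠ ∞ := by
  have hq : 0 < q := hp.trans hpq
  -- One index suffices: the second factor is positive for `N ≥ 1`, so a product below 1 excludes an
  -- infinite moment of the tilt.
  obtain ⟨N, hN, hN1⟩ := ((hlim.eventually (gt_mem_nhds one_pos)).and
    (eventually_ge_atTop 1)).exists
  have hN0 : (0 : ℝ) < N := by exact_mod_cast hN1
  have hV : 0 ≤ growthFactor μ g gmax (θ N) :=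
    le_trans (mul_nonneg (Real.exp_pos _).le (tiltMass_pos hg hgmax _).le)
      (le_growthFactor hg hgmax _)
  refine ne_top_of_le_ne_top ?_ (absMoment_le_tiltedLaw hg hgmax (θ N) q)
  refine ENNReal.mul_ne_top ENNReal.ofReal_ne_top fun htop => ?_
  rw [htop, ENNReal.top_rpow_of_pos (div_pos hp hq), ENNReal.top_mul] at hN
  · exact absurd hN (by simp)
  · exact (ENNReal.ofReal_pos.2 (by positivity)).ne'

/-- The growth condition forces the tilting parameters to grow at most logarithmically. -/
lemma eventually_norm_le_log (hp : 0 < p) (hpq : p < q) (hg : Measurable g)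
    (hgmax : ∀ᵐ x ∂μ, ‖g x‖ ≤ gmax) (hconst : ¬ ∃ v, ∀ᵐ x ∂μ, g x = v)
    (hlim : Tendsto (fun N : ℕ => absMoment q (tiltedLaw μ g (θ N)) ^ (p / q) *
      ENNReal.ofReal (growthFactor μ g gmax (θ N) * (N : ℝ) ^ (-p / (d : ℝ)) +
        (N : ℝ) ^ (-(1 / 2 : ℝ)))) atTop (𝓝 0)) :
    ∃ D : ℝ, 0 < D ∧ ∀ᶠ N : ℕ in atTop, ‖θ N‖ ≤ D * (1 + Real.log N) := by
  have hq : 0 < q := hp.trans hpq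
  have hmtop := absMoment_ne_top hp hpq hg hgmax hlim
  have hm0 : 0 < (absMoment q μ).toReal :=
    ENNReal.toReal_pos (absMoment_ne_zero hq hconst) hmtop
  set a := (absMoment q μ).toReal with ha
  have hc₀ : 0 < gmax - ‖∫ x, g x ∂μ‖ := sub_pos.2 (norm_integral_lt hg hgmax hconst)
  set c₀ := gmax - ‖∫ x, g x ∂μ‖ with hc₀def
  have ht : 0 < 1 - p / q := by rw [sub_pos, div_lt_one hq]; exact hpq
  -- Read off from `hmain` below; the extra 1 only makes `D` positive.
  set D := (p / d + |p / q * Real.log a| + 1) / (c₀ * (1 - p / q)) with hD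
  refine ⟨D, by positivity, ?_⟩
  filter_upwards [hlim.eventually (gt_mem_nhds one_pos), eventually_ge_atTop 1] with N hN hN1
  have hN0 : (0 : ℝ) < N := by exact_mod_cast hN1
  have hlog : 0 ≤ Real.log N := Real.log_nonneg (by exact_mod_cast hN1)
  have hM := tiltMass_pos hg hgmax (θ N)
  set A := Real.exp (‖θ N‖ * gmax) * tiltMass μ g (θ N) with hA
  have hA0 : 0 < A := by positivity
  have hAexp : c₀ * ‖θ N‖ ≤ Real.log A := by
    rw [Real.le_log_iff_exp_le hA0]
    calc Real.exp (c₀ * ‖θ N‖)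
        = Real.exp (‖θ N‖ * gmax) * Real.exp (-(‖θ N‖ * ‖∫ x, g x ∂μ‖)) := by
          rw [← Real.exp_add, hc₀def]; ring_nf
      _ ≤ A := by rw [hA]; gcongr; exact exp_neg_le_tiltMass hg hgmax _
  have hmom : ENNReal.ofReal (a / A) ≤ absMoment q (tiltedLaw μ g (θ N)) := by
    rw [ENNReal.ofReal_div_of_pos hA0, ha, ENNReal.ofReal_toReal hmtop]
    exact ENNReal.div_le_of_le_mul' (absMoment_le_tiltedLaw hg hgmax (θ N) q)
  -- The moment is replaced by its lower bound `a / A` and the growth factor by `A`; since `p / q <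
  -- 1`, a positive power `A^{1-p/q}` survives.
  have hle : ENNReal.ofReal ((a / A) ^ (p / q) * (A * (N : ℝ) ^ (-p / (d : ℝ)))) < 1 := by
    refine lt_of_le_of_lt ?_ hN
    rw [ENNReal.ofReal_mul (by positivity),
      ← ENNReal.ofReal_rpow_of_nonneg (by positivity) (by positivity)]
    gcongr
    refine le_add_of_le_of_nonneg ?_ (by positivity)
    gcongr
    exact le_growthFactor hg hgmax _
  rw [ENNReal.ofReal_lt_one] at hle
  have hlogle := Real.log_neg (by positivity) hle
  rw [Real.log_mul (by positivity) (by positivity), Real.log_rpow (by positivity),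
    Real.log_div hm0.ne' hA0.ne', Real.log_mul hA0.ne' (by positivity), Real.log_rpow hN0]
    at hlogle
  have hmain : c₀ * (1 - p / q) * ‖θ N‖ ≤ p / d * Real.log N + |p / q * Real.log a| := by
    have h1 : (1 - p / q) * (c₀ * ‖θ N‖) ≤ (1 - p / q) * Real.log A := by gcongr
    have h2 := neg_abs_le (p / q * Real.log a)
    have h3 : -p / (d : ℝ) * Real.log N = -(p / d * Real.log N) := by ring
    rw [h3] at hlogle
    nlinarith
  rw [hD, div_mul_eq_mul_div, le_div_iff₀ (by positivity)]
  have h4 : 0 ≤ p / (d : ℝ) := by positivity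
  nlinarith [abs_nonneg (p / q * Real.log a), mul_nonneg (abs_nonneg (p / q * Real.log a)) hlog]

/-- Along the sequence, the densities of the tilts are bounded by any power of `N`. -/
lemma eventually_tiltDensity_le (hp : 0 < p) (hpq : p < q) (hg : Measurable g)
    (hgmax : ∀ᵐ x ∂μ, ‖g x‖ ≤ gmax)
    (hlim : Tendsto (fun N : ℕ => absMoment q (tiltedLaw μ g (θ N)) ^ (p / q) *
      ENNReal.ofReal (growthFactor μ g gmax (θ N) * (N : ℝ) ^ (-p / (d : ℝ)) +
        (N : ℝ) ^ (-(1 / 2 : ℝ)))) atTop (𝓝 0)) {ε : ℝ} (hε : 0 < ε) :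
    ∃ C : ℝ, 0 ≤ C ∧ ∀ᶠ N : ℕ in atTop,
      ∀ᵐ x ∂μ, tiltDensity μ g (θ N) x ≤ C * (N : ℝ) ^ ε := by
  by_cases hconst : ∃ v, ∀ᵐ x ∂μ, g x = v
  · obtain ⟨v, hv⟩ := hconst
    refine ⟨1, zero_le_one, ?_⟩
    filter_upwards [eventually_ge_atTop 1] with N hN
    filter_upwards [tiltDensity_eq_one_of_const hv (θ N)] with x hx
    rw [hx, one_mul]
    exact Real.one_le_rpow (by exact_mod_cast hN) hε.le
  · obtain ⟨D, hD, hθ⟩ := eventually_norm_le_log hp hpq hg hgmax hconst hlim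
    -- The rate `δ = ε / D` turns `‖θ N‖ ≤ D (1 + log N)` into `e^{δ‖θ N‖} ≤ e^ε N^ε`.
    obtain ⟨C, hC, hCb⟩ := exists_tiltDensity_le hg hgmax (div_pos hε hD)
    refine ⟨C * Real.exp ε, by positivity, ?_⟩
    filter_upwards [hθ, eventually_ge_atTop 1] with N hN hN1
    have hN0 : (0 : ℝ) < N := by exact_mod_cast hN1
    filter_upwards [hCb (θ N)] with x hx
    refine hx.trans ?_
    rw [mul_assoc, Real.rpow_def_of_pos hN0, ← Real.exp_add]
    gcongr
    calc ε / D * ‖θ N‖ ≤ ε / D * (D * (1 + Real.log N)) := by gcongr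
      _ = ε + Real.log N * ε := by field_simp

end Sequence

/-! ### The grid and the resulting power bounds. -/

/-- Half-open cubes of side `r` with vertices in `r ℤ^d`. -/
def gridCell (r : ℝ) (k : Fin d → ℤ) : Set (Space d) := {x | ∀ i, ⌊x i / r⌋ = k i}

/-- The indices of the cubes meeting a bounded region around the origin. -/
noncomputable def gridIndex (d K : ℕ) : Finset (Fin d → ℤ) :=
  Fintype.piFinset fun _ => Finset.Icc (-(K : ℤ)) K

lemma measurableSet_gridCell (r : ℝ) (k : Fin d → ℤ) : MeasurableSet (gridCell r k) := by
  have : gridCell r k = ⋂ i, (fun x : Space d => ⌊x i / r⌋) ⁻¹' {k i} := by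
    ext x
    simp [gridCell]
  rw [this]
  refine MeasurableSet.iInter fun i => ?_
  have hm : Measurable fun x : Space d => ⌊x i / r⌋ := by
    refine Int.measurable_floor.comp ?_
    fun_prop
  exact hm (measurableSet_singleton _)

lemma pairwiseDisjoint_gridCell (r : ℝ) (s : Set (Fin d → ℤ)) :
    s.PairwiseDisjoint (gridCell r) := by
  intro k _ l _ hkl
  refine Set.disjoint_left.2 fun x hx hy => hkl ?_
  funext i
  rw [← hx i, ← hy i]

lemma card_gridIndex (d K : ℕ) : (gridIndex d K).card = (2 * K + 1) ^ d := by
  simp only [gridIndex, Fintype.card_piFinset, Int.card_Icc, Finset.prod_const, Finset.card_univ,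
    Fintype.card_fin]
  congr 1
  omega

lemma norm_le_sqrt_mul {x : Space d} {c : ℝ} (hc : 0 ≤ c) (h : ∀ i, |x i| ≤ c) :
    ‖x‖ ≤ √d * c := by
  rw [EuclideanSpace.norm_eq, ← Real.sqrt_sq hc, ← Real.sqrt_mul (Nat.cast_nonneg d)]
  apply Real.sqrt_le_sqrt
  calc ∑ i, ‖x i‖ ^ 2 ≤ ∑ _i : Fin d, c ^ 2 := by
        gcongr with i
        exact h i
    _ = _ := by simp

lemma bounds_of_floor_div_eq {r t : ℝ} (hr : 0 < r) {k : ℤ} (h : ⌊t / r⌋ = k) :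
    k * r ≤ t ∧ t < (k + 1) * r := by
  obtain ⟨h1, h2⟩ := Int.floor_eq_iff.1 h
  exact ⟨(le_div_iff₀ hr).1 h1, (div_lt_iff₀ hr).1 h2⟩

lemma norm_le_of_mem_gridCell {r : ℝ} (hr : 0 < r) {K : ℕ} {k : Fin d → ℤ}
    (hk : k ∈ gridIndex d K) {x : Space d} (hx : x ∈ gridCell r k) :
    ‖x‖ ≤ √d * ((K + 1) * r) := by
  refine norm_le_sqrt_mul (by positivity) fun i => ?_
  obtain ⟨h1, h2⟩ := bounds_of_floor_div_eq hr (hx i)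
  have hki := Finset.mem_Icc.1 (Fintype.mem_piFinset.1 hk i)
  have h3 : -(K : ℝ) ≤ k i := by exact_mod_cast hki.1
  have h4 : (k i : ℝ) ≤ K := by exact_mod_cast hki.2
  rw [abs_le]
  constructor <;> nlinarith

lemma norm_sub_le_of_mem_gridCell {r : ℝ} (hr : 0 < r) {k : Fin d → ℤ} {x y : Space d}
    (hx : x ∈ gridCell r k) (hy : y ∈ gridCell r k) : ‖x - y‖ ≤ √d * r := by
  refine norm_le_sqrt_mul hr.le fun i => ?_
  obtain ⟨h1, h2⟩ := bounds_of_floor_div_eq hr (hx i)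
  obtain ⟨h3, h4⟩ := bounds_of_floor_div_eq hr (hy i)
  rw [PiLp.sub_apply, abs_le]
  constructor <;> nlinarith

lemma le_norm_of_notMem_gridCell {r : ℝ} (hr : 0 < r) {K : ℕ} {x : Space d}
    (hx : x ∉ ⋃ k ∈ gridIndex d K, gridCell r k) : K * r ≤ ‖x‖ := by
  by_contra! h
  refine hx (Set.mem_biUnion (x := fun i => ⌊x i / r⌋) ?_ fun i => rfl)
  refine Fintype.mem_piFinset.2 fun i => Finset.mem_Icc.2 ?_
  have hxi : |x i| < K * r := lt_of_le_of_lt (PiLp.norm_apply_le x i) h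
  obtain ⟨h1, h2⟩ := abs_lt.1 hxi
  constructor
  · refine Int.le_floor.2 ?_
    rw [le_div_iff₀ hr]
    push_cast
    linarith
  · refine Int.floor_le_iff.2 ?_
    rw [div_lt_iff₀ hr]
    push_cast
    linarith

/-- Markov-type tail bound: on `C`, `‖x‖^{p-q} ≤ R^{p-q}` because `p - q ≤ 0`. -/
lemma setLIntegral_rpow_le_absMoment {p q R : ℝ} (hpq : p ≤ q) (hp : 0 ≤ p) (hR : 0 < R)
    (μ : Measure (Space d)) {C : Set (Space d)} (hCm : MeasurableSet C)
    (hC : ∀ x ∈ C, R ≤ ‖x‖) :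
    ∫⁻ x in C, ‖x‖ₑ ^ p ∂μ ≤ ENNReal.ofReal (R ^ (p - q)) * absMoment q μ := by
  unfold absMoment
  rw [← lintegral_const_mul _ (by fun_prop)]
  refine (setLIntegral_mono' hCm fun x hx => ?_).trans (setLIntegral_le_lintegral C _)
  have hx0 : 0 < ‖x‖ := hR.trans_le (hC x hx)
  rw [← ofReal_norm, ENNReal.ofReal_rpow_of_nonneg hx0.le hp,
    ENNReal.ofReal_rpow_of_nonneg hx0.le (hp.trans hpq), ← ENNReal.ofReal_mul (by positivity)]
  apply ENNReal.ofReal_le_ofReal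
  calc ‖x‖ ^ p = ‖x‖ ^ (p - q) * ‖x‖ ^ q := by rw [← Real.rpow_add hx0]; ring_nf
    _ ≤ _ := by
      gcongr ?_ * _
      exact Real.rpow_le_rpow_of_nonpos hR (hC x hx) (by linarith)

/-- The bound of `lintegral_transportCost_le` on a grid of mesh `n ^ (-η)` filling the ball of
radius `n ^ η`. -/
lemma lintegral_transportCost_le_rpow [IsProbabilityMeasure μ] (hg : Measurable g)
    (hgmax : ∀ᵐ x ∂μ, ‖g x‖ ≤ gmax) (θ : Space d) {C ε η : ℝ} {n : ℕ} (hC : 0 ≤ C) (hη : 0 < η)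
    (hL : ∀ᵐ x ∂μ, tiltDensity μ g θ x ≤ C * (n : ℝ) ^ ε)
    {Ω : Type*} [MeasurableSpace Ω] {P : Measure Ω} [IsProbabilityMeasure P]
    {X : ℕ → Ω → Space d} (hX : ∀ i, AEMeasurable (X i) P)
    (hlaw : ∀ i, P.map (X i) = μ) (hindep : iIndepFun X P) (hn : 2 ≤ n)
    {p q : ℝ} (hp : 0 < p) (hpq : p < q) (hmom : absMoment q μ ≠ ∞) :
    ∫⁻ ω, transportCost p (plugIn g θ n fun i => X i ω) (tiltedLaw μ g θ) ∂P ≤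
      ENNReal.ofReal (√d ^ p * (n : ℝ) ^ (-(η * p)) + 2 ^ p *
        (4 * C * (3 * √d) ^ p * 5 ^ d * (n : ℝ) ^ (η * p + 2 * η * d + ε - 1 / 2) +
          21 * C ^ 2 * (absMoment q μ).toReal * (n : ℝ) ^ (2 * ε - η * (q - p)))) := by
  have hn0 : (0 : ℝ) < n := by positivity
  have hn1 : (1 : ℝ) ≤ n := by exact_mod_cast (by omega : 1 ≤ n)
  set r : ℝ := (n : ℝ) ^ (-η) with hr
  have hr0 : 0 < r := by positivity
  -- With mesh `n^{-η}`, this many cubes in each direction reach radius `n^η`. As `n^{2η} ≥ 1`,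
  -- rounding up costs only constants: `K + 1 ≤ 3 n^{2η}` and `2 K + 1 ≤ 5 n^{2η}`.
  set K : ℕ := ⌈(n : ℝ) ^ (2 * η)⌉₊ with hK
  have hK1 : (n : ℝ) ^ (2 * η) ≤ K := Nat.le_ceil _
  have hK2 : (K : ℝ) < (n : ℝ) ^ (2 * η) + 1 := Nat.ceil_lt_add_one (by positivity)
  have hone : (1 : ℝ) ≤ (n : ℝ) ^ (2 * η) := Real.one_le_rpow hn1 (by positivity)
  have hmul : (n : ℝ) ^ (2 * η) * r = (n : ℝ) ^ η := by
    rw [hr, ← Real.rpow_add hn0]; ring_nf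
  have hKr : (n : ℝ) ^ η ≤ K * r := by rw [← hmul]; gcongr
  have hKr' : √d * ((K + 1) * r) ≤ 3 * √d * (n : ℝ) ^ η := by
    rw [← hmul]
    calc √d * ((K + 1) * r) ≤ √d * ((3 * (n : ℝ) ^ (2 * η)) * r) := by gcongr; linarith
      _ = _ := by ring
  have hcard : ((gridIndex d K).card : ℝ) ≤ 5 ^ d * (n : ℝ) ^ (2 * η * d) := by
    rw [card_gridIndex, Real.rpow_mul_natCast hn0.le, ← mul_pow]
    push_cast
    gcongr
    linarith
  have hmeas := measurableSet_gridCell (d := d) r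
  have hbound := lintegral_transportCost_le hg hgmax θ hL hX hlaw hindep hn hp.le (gridIndex d K)
    hmeas (pairwiseDisjoint_gridCell r _)
    (B := ENNReal.ofReal (3 * √d * (n : ℝ) ^ η)) (r := ENNReal.ofReal (√d * r))
    (fun k hk x hx => by
      rw [← ofReal_norm]
      exact ENNReal.ofReal_le_ofReal ((norm_le_of_mem_gridCell hr0 hk hx).trans hKr'))
    (fun k _ x hx y hy => by
      rw [← ofReal_norm]
      exact ENNReal.ofReal_le_ofReal (norm_sub_le_of_mem_gridCell hr0 hx hy))
  have htail := setLIntegral_rpow_le_absMoment (R := (n : ℝ) ^ η) hpq.le hp.le (by positivity) μ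
    (Finset.measurableSet_biUnion (gridIndex d K) fun k _ => hmeas k).compl
    fun x hx => hKr.trans (le_norm_of_notMem_gridCell hr0 hx)
  rw [← ENNReal.ofReal_toReal hmom, ← ENNReal.ofReal_mul (by positivity)] at htail
  refine (hbound.trans (add_le_add le_rfl (mul_le_mul_right (add_le_add le_rfl
    (mul_le_mul_right htail _)) _))).trans ?_
  rw [ENNReal.ofReal_rpow_of_nonneg (by positivity) hp.le,
    ENNReal.ofReal_rpow_of_nonneg (by positivity) hp.le, ← ENNReal.ofReal_natCast,
    show (2 : ℝ≥0∞) = ENNReal.ofReal 2 by simp,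
    ENNReal.ofReal_rpow_of_nonneg (by norm_num) hp.le,
    ← ENNReal.ofReal_mul (by positivity), ← ENNReal.ofReal_mul (by positivity),
    ← ENNReal.ofReal_mul (by positivity), ← ENNReal.ofReal_mul (by positivity),
    ← ENNReal.ofReal_add (by positivity) (by positivity),
    ← ENNReal.ofReal_mul (by positivity), ← ENNReal.ofReal_add (by positivity) (by positivity)]
  apply ENNReal.ofReal_le_ofReal
  have e1 : (√d * r) ^ p = √d ^ p * (n : ℝ) ^ (-(η * p)) := by
    rw [Real.mul_rpow (by positivity) hr0.le, hr, ← Real.rpow_mul hn0.le, neg_mul]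
  have e2 : (3 * √d * (n : ℝ) ^ η) ^ p = (3 * √d) ^ p * (n : ℝ) ^ (η * p) := by
    rw [Real.mul_rpow (by positivity) (by positivity), ← Real.rpow_mul hn0.le]
  have e3 : (n : ℝ) ^ (η * p + 2 * η * d + ε - 1 / 2)
      = (n : ℝ) ^ (η * p) * (n : ℝ) ^ (2 * η * d) * (n : ℝ) ^ ε / √n := by
    rw [Real.rpow_sub hn0, Real.rpow_add hn0, Real.rpow_add hn0, Real.sqrt_eq_rpow]
  have e4 : (n : ℝ) ^ (2 * ε - η * (q - p)) = ((n : ℝ) ^ ε) ^ 2 * ((n : ℝ) ^ η) ^ (p - q) := by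
    rw [← Real.rpow_mul hn0.le, ← Real.rpow_mul_natCast hn0.le, ← Real.rpow_add hn0]
    congr 1
    push_cast
    ring
  rw [e1, e2, e3, e4]
  refine add_le_add le_rfl (mul_le_mul_of_nonneg_left (add_le_add ?_ ?_) (by positivity))
  · calc 2 * ((3 * √d) ^ p * (n : ℝ) ^ (η * p)) *
          (((gridIndex d K).card : ℝ) * (2 * (C * (n : ℝ) ^ ε) / √n))
        ≤ 2 * ((3 * √d) ^ p * (n : ℝ) ^ (η * p)) *
          ((5 ^ d * (n : ℝ) ^ (2 * η * d)) * (2 * (C * (n : ℝ) ^ ε) / √n)) := by gcongr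
      _ = _ := by ring
  · exact le_of_eq (by ring)

lemma tendsto_natCast_rpow_of_neg {a : ℝ} (ha : a < 0) :
    Tendsto (fun n : ℕ => (n : ℝ) ^ a) atTop (𝓝 0) := by
  have := (tendsto_rpow_neg_atTop (neg_pos.2 ha)).comp tendsto_natCast_atTop_atTop
  simpa [Function.comp_def] using this

end Reweighting

theorem corollary2p6 {d : ℕ} {p q gmax : ℝ}
    (hp : 0 < p) (hpq : p < q) (hd : q * p / (q - p) < (d : ℝ))
    (μ : Measure (Reweighting.Space d)) [IsProbabilityMeasure μ]
    (g : Reweighting.Space d → Reweighting.Space d) (hg : Measurable g)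
    (hgmax : ∀ᵐ x ∂μ, ‖g x‖ ≤ gmax)
    {Ω : Type*} [MeasurableSpace Ω] (P : Measure Ω) [IsProbabilityMeasure P]
    (X : ℕ → Ω → Reweighting.Space d) (hX : ∀ i, AEMeasurable (X i) P)
    (hlaw : ∀ i, P.map (X i) = μ) (hindep : iIndepFun X P)
    (θ : ℕ → Reweighting.Space d)
    (hlim : Tendsto
      (fun N : ℕ =>
        Reweighting.absMoment q (Reweighting.tiltedLaw μ g (θ N)) ^ (p / q) *
          ENNReal.ofReal
            (Reweighting.growthFactor μ g gmax (θ N) * (N : ℝ) ^ (-p / (d : ℝ)) +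
              (N : ℝ) ^ (-(1 / 2 : ℝ))))
      atTop (𝓝 0)) :
    Tendsto
      (fun N : ℕ =>
        ∫⁻ ω, Reweighting.transportCost p
          (Reweighting.plugIn g (θ N) N (fun i => X i ω))
          (Reweighting.tiltedLaw μ g (θ N)) ∂P)
      atTop (𝓝 0) := by
  have hqp : 0 < q - p := sub_pos.2 hpq
  have hden : 0 < p + 2 * d := by positivity
  -- Chosen so that cell radius and cell count together cost `N^{1/8}`; with `ε ≤ 1/8` the
  -- fluctuation exponent is at most `-1/4`.
  set η : ℝ := 1 / (8 * (p + 2 * d)) with hη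
  have hη0 : 0 < η := by positivity
  have hη8 : η * p + 2 * η * d = 1 / 8 := by rw [hη]; field_simp
  -- The second bound keeps the tail exponent `2 ε - η (q - p)` at most `-η (q - p) / 2`.
  set ε : ℝ := min (1 / 8) (η * (q - p) / 4) with hε
  have hε0 : 0 < ε := by positivity
  have hε1 : ε ≤ 1 / 8 := min_le_left _ _
  have hε2 : ε ≤ η * (q - p) / 4 := min_le_right _ _
  have hηqp : 0 < η * (q - p) := by positivity
  have hmom := Reweighting.absMoment_ne_top hp hpq hg hgmax hlim
  obtain ⟨C, hC, hdens⟩ := Reweighting.eventually_tiltDensity_le hp hpq hg hgmax hlim hε0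
  have h1 := Reweighting.tendsto_natCast_rpow_of_neg
    (a := -(η * p)) (by rw [neg_lt_zero]; positivity)
  have h2 := Reweighting.tendsto_natCast_rpow_of_neg
    (a := η * p + 2 * η * d + ε - 1 / 2) (by linarith)
  have h3 := Reweighting.tendsto_natCast_rpow_of_neg
    (a := 2 * ε - η * (q - p)) (by linarith)
  have hreal := (h1.const_mul (√d ^ p)).add (((h2.const_mul (4 * C * (3 * √d) ^ p * 5 ^ d)).add
    (h3.const_mul (21 * C ^ 2 * (Reweighting.absMoment q μ).toReal))).const_mul (2 ^ p))
  have hlim0 := ENNReal.tendsto_ofReal hreal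
  simp only [mul_zero, add_zero, ENNReal.ofReal_zero] at hlim0
  refine tendsto_of_tendsto_of_tendsto_of_le_of_le' tendsto_const_nhds hlim0
    (Eventually.of_forall fun _ => zero_le) ?_
  filter_upwards [hdens, eventually_ge_atTop 2] with N hN hN2
  exact Reweighting.lintegral_transportCost_le_rpow hg hgmax (θ N) hC hη0 hN hX hlaw hindep hN2
    hp hpq hmom
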